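/- Let $X$ be a (non-empty, not necessarily connected) Stein manifold of complex dimension $n$, that is, a Hausdorff, second countable complex manifold that is holomorphically convex, whose points are separated by global holomorphic functions, and which has, around each of its points, local coordinates given by global holomorphic functions. Let $G$ be a compact (real) Lie group acting holomorphically on $X$: the action map $G\times X\to X$ is smooth, and $x\mapsto g\cdot x$ is holomorphic for each $g\in G$. Then there is a point $x\in X$ whose orbit $G\cdot x$ has real dimension at most $n$, where the real dimension of the orbit is the dimension of its tangent space at $x$, i.e. of the image of $T_1G$ under the differential at $1$ of the orbit map $g\mapsto g\cdot x$. -/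

import Mathlib

open scoped Manifold ContDiff

section SteinManifolds

variable (E : Type*) [NormedAddCommGroup E] [NormedSpace ℂ E]
  {X : Type*} [TopologicalSpace X] [ChartedSpace E X]

/-- The holomorphically convex hull of `K` in the complex manifold `X` modelled on `E`:
the points `x` with `|f x| ≤ sup_K |f|` for all holomorphic functions `f : X → ℂ`
(the supremum being replaced by all upper bounds `C` of `|f|` on `K`). -/
def holomorphicHull (K : Set X) : Set X :=
  {x | ∀ f : X → ℂ, MDifferentiable 𝓘(ℂ, E) 𝓘(ℂ) f →
    ∀ C : ℝ, (∀ y ∈ K, ‖f y‖ ≤ C) → ‖f x‖ ≤ C}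

variable (X) in
/-- A complex manifold `X` (Hausdorff, second countable, modelled on the finite-dimensional
complex vector space `E`) is Stein if it is holomorphically convex, holomorphically separable,
and has local coordinates at every point given by global holomorphic functions; a choice of
`dim E` global functions is the same as a global holomorphic map to `E`.
No connectedness is required. -/
structure IsSteinManifold : Prop where
  holomorphicallyConvex : ∀ K : Set X, IsCompact K → IsCompact (holomorphicHull E K)
  separatesPoints : ∀ x y : X, x ≠ y →
    ∃ f : X → ℂ, MDifferentiable 𝓘(ℂ, E) 𝓘(ℂ) f ∧ f x ≠ f y
  localCoordinates : ∀ x : X, ∃ f : X → E, MDifferentiable 𝓘(ℂ, E) 𝓘(ℂ, E) f ∧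
    Function.Bijective (mfderiv 𝓘(ℂ, E) 𝓘(ℂ, E) f x)

end SteinManifolds

section Actions

variable {EG : Type*} [NormedAddCommGroup EG] [NormedSpace ℝ EG]
  {HG : Type*} [TopologicalSpace HG] (I : ModelWithCorners ℝ EG HG)
  (G : Type*) [TopologicalSpace G] [ChartedSpace HG G] [Group G]
  (E : Type*) [NormedAddCommGroup E] [NormedSpace ℂ E]
  {X : Type*} [TopologicalSpace X] [ChartedSpace E X] [MulAction G X]

variable (X) in
/-- A holomorphic action of a real Lie group `G` on a complex manifold `X`: the action map
`G × X → X` is smooth, for the underlying real manifold structure of `X` (given by the same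
charts, with `E` as a real vector space), and each `g : G` acts by a holomorphic map. -/
structure IsHolomorphicAction : Prop where
  smooth : ContMDiffSMul I 𝓘(ℝ, E) ∞ G X
  holomorphic : ∀ g : G, MDifferentiable 𝓘(ℂ, E) 𝓘(ℂ, E) (fun x : X => g • x)

/-- The real tangent space of the orbit of `x` at the point `1 • x = x`: the image of the
Lie algebra `T₁G` under the differential at `1` of the orbit map `g ↦ g • x`. (For a smooth action
the orbit map has constant rank and induces an injective immersion of `G / Gₓ` onto the orbit,
so this is the tangent space of the orbit as an immersed real submanifold.) -/
noncomputable def orbitTangentSpace (x : X) :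
    Submodule ℝ (TangentSpace 𝓘(ℝ, E) ((1 : G) • x)) :=
  (mfderiv I 𝓘(ℝ, E) (fun g : G => g • x) 1).range

/-- The real dimension of the orbit of `x`, that is, the dimension of its tangent space. -/
noncomputable def orbitRealDim (x : X) : ℕ :=
  Module.finrank ℝ (orbitTangentSpace I G E x)

end Actions

/-! The method is to minimise an invariant strictly plurisubharmonic function. Fix an orbit C. Its
holomorphic hull is compact, so it lies in the interior of a compact `G`-invariant set N. The
definition of the hull and the local coordinates give finitely many holomorphic f_i such that ρ = ∑
|f_i|² is at most 3/4 on C, at least 1 on N \ interior N, and strictly plurisubharmonic on N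
(`IsSteinManifold.exists_family`). The Haar average u of ρ is invariant and keeps this gap, so its
minimum over N is attained at an interior point x, and every point of the orbit of x is a local
minimum.

Hence the gradient of u vanishes along the orbit, and the Hessian of u kills the tangent vectors of
the orbit (`ContMDiffOn.integral_hessian_eq_zero`). If the orbit had dimension greater than n, its
tangent space would contain some v ≠ 0 together with iv (`exists_mem_I_smul_mem`). But the Hessian
at (v, v) plus that at (iv, iv) is the average over g of 4 ∑ |d(f_i ∘ g⁻¹) v|² (`levi_sum_norm_sq`),
which is positive by the choice of the f_i. -/

open Set Filter Topology MeasureTheory Metric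

/-! ### Smoothness of holomorphic maps via Cauchy's formula on complex lines -/

section Osgood

variable {E F : Type*} [NormedAddCommGroup E] [NormedSpace ℂ E]
  [NormedAddCommGroup F] [NormedSpace ℂ F]

theorem hasDerivAt_comp_line {f : E → F} {z v : E} {ζ : ℂ}
    (hf : DifferentiableAt ℂ f (z + ζ • v)) :
    HasDerivAt (fun ξ : ℂ => f (z + ξ • v)) (fderiv ℂ f (z + ζ • v) v) ζ := by
  have h : HasDerivAt (fun ξ : ℂ => z + ξ • v) v ζ := by
    simpa using ((hasDerivAt_id ζ).smul_const v).const_add z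
  exact hf.hasFDerivAt.comp_hasDerivAt ζ h

/-- A complex differentiable map has locally bounded derivative, by the Cauchy estimates. -/
theorem exists_norm_fderiv_le {f : E → F} {U : Set E} (hU : IsOpen U)
    (hf : DifferentiableOn ℂ f U) {z : E} (hz : z ∈ U) :
    ∃ ε > 0, ball z ε ⊆ U ∧ ∃ B : ℝ, ∀ y ∈ ball z ε, ‖fderiv ℂ f y‖ ≤ B := by
  have hc : ContinuousAt f z := (hf.differentiableAt (hU.mem_nhds hz)).continuousAt
  have h1 : ∀ᶠ y in 𝓝 z, ‖f y‖ < ‖f z‖ + 1 :=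
    hc.norm.eventually (gt_mem_nhds (by linarith))
  obtain ⟨R, hR, hRU⟩ := Metric.mem_nhds_iff.1 (inter_mem (hU.mem_nhds hz) h1)
  refine ⟨R / 2, by positivity, fun y hy => (hRU (ball_subset_ball (by linarith) hy)).1,
    4 * (‖f z‖ + 1) / R, fun y hy => ?_⟩
  refine ContinuousLinearMap.opNorm_le_bound _ (by positivity) fun w => ?_
  rcases eq_or_ne w 0 with rfl | hw
  · simp
  have hw' : 0 < ‖w‖ := norm_pos_iff.2 hw
  -- Since `y` is within `R / 2` of `z`, the disc of radius `r` in direction `w` stays in `ball z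
  -- R`, where `‖f‖ < ‖f z‖ + 1`.
  set r : ℝ := R / (4 * ‖w‖) with hr
  have hr0 : 0 < r := by positivity
  have hmem : ∀ ζ : ℂ, ‖ζ‖ ≤ r → y + ζ • w ∈ ball z R := by
    intro ζ hζ
    have h2 : ‖ζ • w‖ ≤ R / 4 := by
      rw [norm_smul]
      calc ‖ζ‖ * ‖w‖ ≤ r * ‖w‖ := by gcongr
        _ = R / 4 := by rw [hr]; field_simp
    rw [mem_ball, dist_eq_norm] at hy ⊢
    calc ‖y + ζ • w - z‖ = ‖(y - z) + ζ • w‖ := by congr 1; abel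
      _ ≤ ‖y - z‖ + ‖ζ • w‖ := norm_add_le _ _
      _ < R := by linarith
  have hd : ∀ ζ : ℂ, ‖ζ‖ ≤ r →
      HasDerivAt (fun ξ : ℂ => f (y + ξ • w)) (fderiv ℂ f (y + ζ • w) w) ζ := fun ζ hζ =>
    hasDerivAt_comp_line (hf.differentiableAt (hU.mem_nhds (hRU (hmem ζ hζ)).1))
  have hdiff : DiffContOnCl ℂ (fun ξ : ℂ => f (y + ξ • w)) (ball 0 r) := by
    apply DifferentiableOn.diffContOnCl
    intro ζ hζ
    have : ‖ζ‖ ≤ r := by simpa using closure_ball_subset_closedBall hζ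
    exact (hd ζ this).differentiableAt.differentiableWithinAt
  have hle := Complex.norm_deriv_le_of_forall_mem_sphere_norm_le hr0 hdiff
    (C := ‖f z‖ + 1) fun ζ hζ => (hRU (hmem ζ (by simpa using hζ.le))).2.le
  have h0 := (hd 0 (by simpa using hr0.le)).deriv
  rw [h0] at hle
  simp only [zero_smul, add_zero] at hle
  refine hle.trans_eq ?_
  rw [hr]; field_simp

variable [FiniteDimensional ℂ E] [FiniteDimensional ℂ F]

/-- The directional derivatives of a complex differentiable map are complex differentiable. -/
theorem differentiableOn_fderiv_apply_complex {f : E → F} {U : Set E} (hU : IsOpen U)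
    (hf : DifferentiableOn ℂ f U) (v : E) :
    DifferentiableOn ℂ (fun z => fderiv ℂ f z v) U := by
  intro z hz
  apply DifferentiableAt.differentiableWithinAt
  have : CompleteSpace F := FiniteDimensional.complete ℂ F
  have : ProperSpace (E →L[ℂ] F) := FiniteDimensional.proper ℂ _
  let : MeasurableSpace E := borel E
  have : BorelSpace E := ⟨rfl⟩
  let : MeasurableSpace (E →L[ℂ] F) := borel _
  have : BorelSpace (E →L[ℂ] F) := ⟨rfl⟩
  obtain ⟨ε, hε, hεU, B, hB⟩ := exists_norm_fderiv_le hU hf hz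
  set δ : ℝ := ε / (2 * (‖v‖ + 1)) with hδ
  have hδ0 : 0 < δ := by positivity
  have hmem : ∀ y ∈ ball z (ε / 2), ∀ ζ : ℂ, ‖ζ‖ ≤ δ → y + ζ • v ∈ ball z ε := by
    intro y hy ζ hζ
    have h2 : ‖ζ • v‖ ≤ ε / 2 := by
      rw [norm_smul]
      calc ‖ζ‖ * ‖v‖ ≤ δ * (‖v‖ + 1) := by gcongr; linarith
        _ = ε / 2 := by rw [hδ]; field_simp
    rw [mem_ball, dist_eq_norm] at hy ⊢
    calc ‖y + ζ • v - z‖ = ‖(y - z) + ζ • v‖ := by congr 1; abel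
      _ ≤ ‖y - z‖ + ‖ζ • v‖ := norm_add_le _ _
      _ < ε := by linarith
  have hda : ∀ y ∈ ball z (ε / 2), ∀ ζ : ℂ, ‖ζ‖ ≤ δ → DifferentiableAt ℂ f (y + ζ • v) :=
    fun y hy ζ hζ => hf.differentiableAt (hU.mem_nhds (hεU (hmem y hy ζ hζ)))
  -- The kernel dζ / ζ² on the circle: it writes the directional derivative as an integral of `f`
  -- itself, so differentiating in `y` needs only the first derivative of `f`.
  let k : ℝ → ℂ := fun θ => deriv (circleMap 0 δ) θ * (1 / (circleMap 0 δ θ - 0) ^ 2)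
  have hne : ∀ θ, circleMap 0 δ θ - 0 ≠ 0 := fun θ => by
    simp [circleMap, hδ0.ne']
  have hk : Continuous k := by
    have h3 : Continuous (deriv (circleMap (0 : ℂ) δ)) := by
      have : deriv (circleMap (0 : ℂ) δ) = fun θ => circleMap 0 δ θ * Complex.I := by
        ext θ; simp
      rw [this]; fun_prop
    exact h3.mul (continuous_const.div (by fun_prop) fun θ => pow_ne_zero 2 (hne θ))
  have hnorm : ∀ θ, ‖circleMap (0 : ℂ) δ θ‖ ≤ δ := fun θ => by simp [abs_of_pos hδ0]
  have hcauchy : ∀ y ∈ ball z (ε / 2),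
      ∫ θ in (0 : ℝ)..2 * Real.pi, k θ • f (y + circleMap 0 δ θ • v) =
        (2 * Real.pi * Complex.I : ℂ) • fderiv ℂ f y v := by
    intro y hy
    have hc : DifferentiableOn ℂ (fun ξ : ℂ => f (y + ξ • v)) (closedBall 0 δ) := fun ζ hζ =>
      (hasDerivAt_comp_line
        (hda y hy ζ (by simpa using hζ))).differentiableAt.differentiableWithinAt
    have h4 := DifferentiableOn.deriv_eq_smul_circleIntegral hδ0 hc
    have h5 := (hasDerivAt_comp_line (v := v) (ζ := 0) (hda y hy 0 (by simpa using hδ0.le))).deriv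
    rw [h5] at h4
    simp only [zero_smul, add_zero] at h4
    rw [← h4, circleIntegral]
    simp only [k, mul_smul]
  have hcont : ∀ y ∈ ball z (ε / 2), Continuous fun θ => k θ • f (y + circleMap 0 δ θ • v) := by
    intro y hy
    refine hk.smul (continuous_iff_continuousAt.2 fun θ => ?_)
    have h6 : ContinuousAt (fun θ => y + circleMap 0 δ θ • v) θ := by fun_prop
    exact ContinuousAt.comp (f := fun θ => y + circleMap 0 δ θ • v) (g := f)
      (hda y hy _ (hnorm θ)).continuousAt h6
  have hs : ball z (ε / 2) ∈ 𝓝 z := ball_mem_nhds _ (by positivity)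
  have key := intervalIntegral.hasFDerivAt_integral_of_dominated_of_fderiv_le (𝕜 := ℂ)
    (μ := volume) (a := 0) (b := 2 * Real.pi) (s := ball z (ε / 2)) (x₀ := z)
    (F := fun y θ => k θ • f (y + circleMap 0 δ θ • v))
    (F' := fun y θ => k θ • fderiv ℂ f (y + circleMap 0 δ θ • v))
    (bound := fun θ => ‖k θ‖ * B) hs
    (eventually_of_mem hs fun y hy => (hcont y hy).aestronglyMeasurable)
    ((hcont z (mem_ball_self (by positivity))).intervalIntegrable _ _)
    (by
      refine AEStronglyMeasurable.smul hk.aestronglyMeasurable ?_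
      -- Continuity of `fderiv ℂ f` is not yet known at this stage; its measurability is automatic.
      refine Measurable.aestronglyMeasurable ?_
      exact (measurable_fderiv ℂ f).comp (by fun_prop : Continuous
        fun θ => z + circleMap 0 δ θ • v).measurable)
    (Eventually.of_forall fun θ _ y hy => by
      rw [norm_smul]
      exact mul_le_mul_of_nonneg_left (hB _ (hmem y hy _ (hnorm θ))) (norm_nonneg _))
    ((hk.norm.mul continuous_const).intervalIntegrable _ _)
    (Eventually.of_forall fun θ _ y hy => by
      refine HasFDerivAt.const_smul ?_ _
      have h7 := (hda y hy _ (hnorm θ)).hasFDerivAt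
      exact h7.comp y ((hasFDerivAt_id y).add_const _))
  have hd := key.differentiableAt.const_smul (2 * Real.pi * Complex.I : ℂ)⁻¹
  refine hd.congr_of_eventuallyEq (eventually_of_mem hs fun y hy => ?_)
  simp only [Pi.smul_apply]
  rw [hcauchy y hy, inv_smul_smul₀]
  simp [Real.pi_ne_zero]

/-- **Osgood's lemma**: complex Fréchet differentiable maps are smooth. -/
theorem contDiffOn_of_differentiableOn_complex {f : E → F} {U : Set E} (hU : IsOpen U)
    (hf : DifferentiableOn ℂ f U) : ContDiffOn ℂ ∞ f U := by
  refine contDiffOn_infty.2 fun n => ?_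
  induction n generalizing f with
  | zero => simpa using hf.continuousOn
  | succ n ih =>
    push_cast
    rw [contDiffOn_succ_iff_fderiv_of_isOpen hU]
    refine ⟨hf, by simp, contDiffOn_clm_apply.2 fun v => ih (differentiableOn_fderiv_apply_complex hU hf v)⟩

end Osgood

/-! ### Underlying real structure; openness of immersivity -/

section RealStructure

variable {E : Type*} [NormedAddCommGroup E] [NormedSpace ℂ E]
  {F : Type*} [NormedAddCommGroup F] [NormedSpace ℂ F]
  {X : Type*} [TopologicalSpace X] [ChartedSpace E X]

/-- The real manifold underlying a complex manifold. -/
theorem isManifold_real_of_complex [IsManifold 𝓘(ℂ, E) ω X] : IsManifold 𝓘(ℝ, E) ∞ X := by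
  refine isManifold_of_contDiffOn _ _ _ fun e e' he he' => ?_
  have h := (contDiffGroupoid ω 𝓘(ℂ, E)).compatible he he'
  have h' : e.symm ≫ₕ e' ∈ contDiffGroupoid ∞ 𝓘(ℂ, E) := (contDiffGroupoid_le (I := 𝓘(ℂ, E)) (le_top : (∞ : ℕ∞ω) ≤ ω)) h
  have h2 : ContDiffOn ℂ ∞ (e.symm ≫ₕ e') (e.symm ≫ₕ e').source := by
    have h3 := (mem_groupoid_of_pregroupoid.1 (by rwa [contDiffGroupoid] at h')).1
    simpa [contDiffPregroupoid] using h3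
  simpa using h2.restrict_scalars ℝ

variable [IsManifold 𝓘(ℂ, E) ω X]

theorem differentiableOn_comp_chart_symm {f : X → F}
    (hf : MDifferentiable 𝓘(ℂ, E) 𝓘(ℂ, F) f) (x : X) :
    DifferentiableOn ℂ (f ∘ (chartAt E x).symm) (chartAt E x).target := by
  rw [← mdifferentiableOn_iff_differentiableOn]
  exact hf.comp_mdifferentiableOn (mdifferentiableOn_atlas_symm (chart_mem_atlas E x))

theorem mfderiv_eq_fderiv_chart {f : X → F}
    (hf : MDifferentiable 𝓘(ℂ, E) 𝓘(ℂ, F) f) (x : X) :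
    mfderiv 𝓘(ℂ, E) 𝓘(ℂ, F) f x = fderiv ℂ (f ∘ (chartAt E x).symm) (chartAt E x x) := by
  rw [(hf x).mfderiv]
  simp only [writtenInExtChartAt, extChartAt, mfld_simps, fderivWithin_univ,
    chartAt_self_eq]
  rfl

variable [FiniteDimensional ℂ E]

variable [FiniteDimensional ℂ F]

theorem contDiffOn_comp_chart_symm {f : X → F}
    (hf : MDifferentiable 𝓘(ℂ, E) 𝓘(ℂ, F) f) (x : X) :
    ContDiffOn ℂ ∞ (f ∘ (chartAt E x).symm) (chartAt E x).target :=
  contDiffOn_of_differentiableOn_complex (chartAt E x).open_target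
    (differentiableOn_comp_chart_symm hf x)

/-- A holomorphic map is smooth for the underlying real structures. -/
theorem MDifferentiable.contMDiff_real {f : X → F}
    (hf : MDifferentiable 𝓘(ℂ, E) 𝓘(ℂ, F) f) : ContMDiff 𝓘(ℝ, E) 𝓘(ℝ, F) ∞ f := by
  have := isManifold_real_of_complex (E := E) (X := X)
  intro x
  have h1 : ContMDiffOn 𝓘(ℝ, E) 𝓘(ℝ, F) ∞ (f ∘ (chartAt E x).symm) (chartAt E x).target :=
    ((contDiffOn_comp_chart_symm hf x).restrict_scalars ℝ).contMDiffOn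
  have h2 : ContMDiffOn 𝓘(ℝ, E) 𝓘(ℝ, E) ∞ (chartAt E x) (chartAt E x).source :=
    contMDiffOn_chart
  have h3 := h1.comp h2 (chartAt E x).mapsTo
  have h4 : ContMDiffOn 𝓘(ℝ, E) 𝓘(ℝ, F) ∞ f (chartAt E x).source :=
    h3.congr fun y hy => by simp [(chartAt E x).left_inv hy]
  exact h4.contMDiffAt ((chartAt E x).open_source.mem_nhds (mem_chart_source E x))

end RealStructure

section Immersion

variable {E : Type*} [NormedAddCommGroup E] [NormedSpace ℂ E] [FiniteDimensional ℂ E]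
  {X : Type*} [TopologicalSpace X] [ChartedSpace E X] [IsManifold 𝓘(ℂ, E) ω X]

/-- In the fixed chart at `x` the derivative varies continuously and injectivity is an open
condition. Since `mfderiv` at `y` uses the chart at `y`, the chain rule with the invertible
derivative of the fixed chart transfers the result. -/
theorem eventually_injective_mfderiv {f : X → E}
    (hf : MDifferentiable 𝓘(ℂ, E) 𝓘(ℂ, E) f) (x : X)
    (hx : Function.Injective (mfderiv 𝓘(ℂ, E) 𝓘(ℂ, E) f x)) :
    ∀ᶠ y in 𝓝 x, Function.Injective (mfderiv 𝓘(ℂ, E) 𝓘(ℂ, E) f y) := by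
  set e := chartAt E x
  have : CompleteSpace E := FiniteDimensional.complete ℂ E
  have hU : e.target ∈ 𝓝 (e x) := e.open_target.mem_nhds (mem_chart_target E x)
  have hc : ContinuousAt (fderiv ℂ (f ∘ e.symm)) (e x) :=
    ((contDiffOn_comp_chart_symm hf x).continuousOn_fderiv_of_isOpen e.open_target
      (by simp)).continuousAt hU
  have hc' : ContinuousAt (fun y => fderiv ℂ (f ∘ e.symm) (e y)) x :=
    ContinuousAt.comp (g := fderiv ℂ (f ∘ e.symm)) hc
      (e.continuousAt (mem_chart_source E x))
  have hopen := ContinuousLinearMap.isOpen_injective (𝕜 := ℂ) (E := E) (F := E)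
  have hmem : fderiv ℂ (f ∘ e.symm) (e x) ∈ {L : E →L[ℂ] E | Function.Injective L} := by
    rw [mfderiv_eq_fderiv_chart hf] at hx
    exact hx
  filter_upwards [hc'.eventually (hopen.mem_nhds hmem),
    e.open_source.mem_nhds (mem_chart_source E x)] with y hy hys
  have he : e.MDifferentiable 𝓘(ℂ, E) 𝓘(ℂ, E) :=
    mdifferentiable_of_mem_atlas (chart_mem_atlas E x)
  have h1 : mfderiv 𝓘(ℂ, E) 𝓘(ℂ, E) f y =
      (mfderiv 𝓘(ℂ, E) 𝓘(ℂ, E) (f ∘ e.symm) (e y)).comp (mfderiv 𝓘(ℂ, E) 𝓘(ℂ, E) e y) := by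
    have hg : MDifferentiableAt 𝓘(ℂ, E) 𝓘(ℂ, E) (f ∘ e.symm) (e y) :=
      ((differentiableOn_comp_chart_symm hf x).differentiableAt
        (e.open_target.mem_nhds (e.mapsTo hys))).mdifferentiableAt
    rw [← mfderiv_comp y hg (he.mdifferentiableAt hys)]
    refine Filter.EventuallyEq.mfderiv_eq ?_
    filter_upwards [e.open_source.mem_nhds hys] with w hw
    simp [e.left_inv hw]
  rw [h1, mfderiv_eq_fderiv]
  exact hy.comp (he.mfderiv_injective hys)

end Immersion

/-! ### Finite families of holomorphic functions on Stein manifolds -/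

section SteinFamilies

universe u v

variable {E : Type v} [NormedAddCommGroup E] [NormedSpace ℂ E]
  {X : Type u} [TopologicalSpace X] [ChartedSpace E X]

/-- Finitely many holomorphic functions separate a compact set from another one that does not
meet its holomorphic hull. -/
theorem exists_family_separating_of_disjoint_hull {C B : Set X} (hCne : C.Nonempty)
    (hB : IsCompact B) (hBC : ∀ y ∈ B, y ∉ holomorphicHull E C) :
    ∃ (ι : Type u) (_ : Fintype ι) (f : ι → X → ℂ),
      (∀ i, MDifferentiable 𝓘(ℂ, E) 𝓘(ℂ) (f i)) ∧
      (∀ x ∈ C, ∑ i, ‖f i x‖ ^ 2 ≤ 1 / 2) ∧ ∀ y ∈ B, 1 ≤ ∑ i, ‖f i y‖ ^ 2 := by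
  have h1 : ∀ y ∈ B, ∃ (g : X → ℂ) (q : ℝ), MDifferentiable 𝓘(ℂ, E) 𝓘(ℂ) g ∧ 0 ≤ q ∧ q < 1 ∧
      (∀ x ∈ C, ‖g x‖ ≤ q) ∧ 1 < ‖g y‖ := by
    intro y hy
    have := hBC y hy
    simp only [holomorphicHull, mem_ofPred_eq, not_forall, not_le] at this
    obtain ⟨f, hf, D, hD, hDy⟩ := this
    obtain ⟨p, hp⟩ := hCne
    have hD0 : 0 ≤ D := (norm_nonneg _).trans (hD p hp)
    -- Dividing by the midpoint of `D < ‖f y‖` puts the values on `C` below 1 and the value at `y`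
    -- above 1.
    set c : ℝ := (D + ‖f y‖) / 2 with hc
    have hc0 : 0 < c := by linarith
    have hn : ∀ x, ‖(c : ℂ)⁻¹ * f x‖ = ‖f x‖ / c := fun x => by
      rw [norm_mul, norm_inv, Complex.norm_real, Real.norm_of_nonneg hc0.le]; field_simp
    refine ⟨fun x => (c : ℂ)⁻¹ * f x, D / c,
      (by fun_prop : Differentiable ℂ fun w : ℂ => (c : ℂ)⁻¹ * w).mdifferentiable.comp hf,
      by positivity, ?_, fun x hx => ?_, ?_⟩
    · rw [div_lt_one hc0]; linarith
    · rw [hn]; gcongr; exact hD x hx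
    · rw [hn, one_lt_div hc0]; linarith
  choose! g q hg hq0 hq1 hgC hgy using h1
  obtain ⟨t, htB, ht⟩ := hB.elim_nhds_subcover (fun y => {x | 1 < ‖g y x‖}) fun y hy =>
    (isOpen_lt continuous_const (hg y hy).continuous.norm).mem_nhds (hgy y hy)
  -- A common high power makes the sum small on `C` and keeps moduli above 1 above 1.
  have hlim : Tendsto (fun k : ℕ => ∑ i : t, (q i ^ 2) ^ k) atTop (𝓝 (∑ i : t, (0 : ℝ))) :=
    tendsto_finsetSum _ fun i _ => tendsto_pow_atTop_nhds_zero_of_lt_one (by positivity)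
      (pow_lt_one₀ (hq0 i (htB i i.2)) (hq1 i (htB i i.2)) two_ne_zero)
  rw [Finset.sum_const_zero] at hlim
  obtain ⟨k, hk⟩ := (hlim.eventually (ge_mem_nhds (by norm_num : (0 : ℝ) < 1 / 2))).exists
  refine ⟨t, inferInstance, fun i x => g i x ^ k, fun i =>
    (by fun_prop : Differentiable ℂ fun w : ℂ => w ^ k).mdifferentiable.comp (hg i (htB i i.2)),
    fun x hx => ?_, fun y hy => ?_⟩
  · refine le_trans (Finset.sum_le_sum fun i _ => ?_) hk
    rw [norm_pow, ← pow_mul, mul_comm, pow_mul]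
    gcongr
    exact hgC i (htB i i.2) x hx
  · obtain ⟨i, hi, hiy⟩ := mem_iUnion₂.1 (ht hy)
    refine le_trans ?_ (Finset.single_le_sum (f := fun i : t => ‖g i y ^ k‖ ^ 2)
      (fun _ _ => by positivity) (Finset.mem_univ (⟨i, hi⟩ : t)))
    simp only [norm_pow]
    exact one_le_pow₀ (one_le_pow₀ (le_of_lt hiy))

variable [FiniteDimensional ℂ E] [IsManifold 𝓘(ℂ, E) ω X]

/-- On a compact subset of a Stein manifold, the differentials of finitely many global holomorphic
functions separate tangent vectors. -/
theorem IsSteinManifold.exists_family_immersive (hX : IsSteinManifold E X) {N : Set X}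
    (hN : IsCompact N) :
    ∃ (ι : Type u) (_ : Fintype ι) (f : ι → X → ℂ),
      (∀ i, MDifferentiable 𝓘(ℂ, E) 𝓘(ℂ) (f i)) ∧
      ∀ x ∈ N, ∀ v : E,
        (∀ i, fderiv ℂ (f i ∘ (chartAt E x).symm) (chartAt E x x) v = 0) → v = 0 := by
  choose h hh hinj using hX.localCoordinates
  obtain ⟨t, -, ht⟩ := hN.elim_nhds_subcover
    (fun x => {y | Function.Injective (mfderiv 𝓘(ℂ, E) 𝓘(ℂ, E) (h x) y)}) fun x _ =>
    eventually_injective_mfderiv (hh x) x (hinj x).1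
  let b := Module.finBasis ℂ E
  let L : Fin (Module.finrank ℂ E) → E →L[ℂ] ℂ := fun l => (b.coord l).toContinuousLinearMap
  refine ⟨t × Fin (Module.finrank ℂ E), inferInstance, fun i x => L i.2 (h i.1 x), fun i =>
    (L i.2).differentiable.mdifferentiable.comp (hh i.1), fun x hx v hv => ?_⟩
  obtain ⟨y, hy, hyx⟩ := mem_iUnion₂.1 (ht hx)
  simp only [mem_ofPred_eq] at hyx
  rw [mfderiv_eq_fderiv_chart (hh y)] at hyx
  set e := chartAt E x
  have hd : DifferentiableAt ℂ (h y ∘ e.symm) (e x) :=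
    (differentiableOn_comp_chart_symm (hh y) x).differentiableAt
      (e.open_target.mem_nhds (mem_chart_target E x))
  apply hyx
  refine Eq.trans (b := (0 : E)) ?_ (map_zero (fderiv ℂ (h y ∘ e.symm) (e x))).symm
  refine b.ext_elem fun l => ?_
  have h1 := hv (⟨y, hy⟩, l)
  have h2 : HasFDerivAt ((fun x => L l (h y x)) ∘ e.symm)
      ((L l).comp (fderiv ℂ (h y ∘ e.symm) (e x))) (e x) :=
    (L l).hasFDerivAt.comp (e x) hd.hasFDerivAt
  rw [h2.fderiv] at h1
  exact h1.trans (by simp)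

/-- The finite family of holomorphic functions whose sum of squared moduli serves as a
strictly plurisubharmonic function with a local minimum near the hull of `C`. -/
theorem IsSteinManifold.exists_family (hX : IsSteinManifold E X) {C B N : Set X}
    (hC : IsCompact C) (hCne : C.Nonempty) (hN : IsCompact N)
    (hB : IsCompact B) (hBC : ∀ y ∈ B, y ∉ holomorphicHull E C) :
    ∃ (ι : Type u) (_ : Fintype ι) (f : ι → X → ℂ),
      (∀ i, MDifferentiable 𝓘(ℂ, E) 𝓘(ℂ) (f i)) ∧
      (∀ x ∈ C, ∑ i, ‖f i x‖ ^ 2 ≤ 3 / 4) ∧ (∀ y ∈ B, 1 ≤ ∑ i, ‖f i y‖ ^ 2) ∧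
      ∀ x ∈ N, ∀ v : E,
        (∀ i, fderiv ℂ (f i ∘ (chartAt E x).symm) (chartAt E x x) v = 0) → v = 0 := by
  obtain ⟨ι, _, f, hf, hfC, hfB⟩ := exists_family_separating_of_disjoint_hull hCne hB hBC
  obtain ⟨κ, _, h, hh, hinj⟩ := hX.exists_family_immersive hN
  have hcont : Continuous fun x => ∑ j, ‖h j x‖ ^ 2 :=
    continuous_finsetSum _ fun j _ => (hh j).continuous.norm.pow 2
  obtain ⟨M, hM⟩ := (hC.image hcont).bddAbove
  have hM' : ∀ x ∈ C, ∑ j, ‖h j x‖ ^ 2 ≤ |M| + 1 := fun x hx =>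
    (hM (mem_image_of_mem _ hx)).trans ((le_abs_self M).trans (by linarith))
  -- Chosen so that the immersive family adds at most 1/4 to the bound 1/2 on `C`; a nonzero factor
  -- does not change the common kernel of the differentials.
  set ε : ℝ := Real.sqrt (1 / (4 * (|M| + 1))) with hε
  have hpos : 0 < 1 / (4 * (|M| + 1)) := by positivity
  have hε0 : 0 < ε := Real.sqrt_pos.2 hpos
  have hε2 : ε ^ 2 = 1 / (4 * (|M| + 1)) := Real.sq_sqrt hpos.le
  refine ⟨ι ⊕ κ, inferInstance, Sum.elim f fun j x => (ε : ℂ) * h j x, ?_, ?_, ?_, ?_⟩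
  · rintro (i | j)
    · exact hf i
    · exact (by fun_prop : Differentiable ℂ fun w : ℂ => (ε : ℂ) * w).mdifferentiable.comp (hh j)
  · intro x hx
    have h1 : ∑ j, ‖(ε : ℂ) * h j x‖ ^ 2 = ε ^ 2 * ∑ j, ‖h j x‖ ^ 2 := by
      rw [Finset.mul_sum]
      refine Finset.sum_congr rfl fun j _ => ?_
      rw [norm_mul, mul_pow, Complex.norm_real, Real.norm_of_nonneg hε0.le]
    have h2 : ε ^ 2 * ∑ j, ‖h j x‖ ^ 2 ≤ 1 / 4 := by
      calc ε ^ 2 * ∑ j, ‖h j x‖ ^ 2 ≤ ε ^ 2 * (|M| + 1) := by gcongr; exact hM' x hx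
        _ = 1 / 4 := by rw [hε2]; field_simp
    simp only [Fintype.sum_sum_type, Sum.elim_inl, Sum.elim_inr]
    linarith [hfC x hx]
  · intro y hy
    simp only [Fintype.sum_sum_type, Sum.elim_inl, Sum.elim_inr]
    have : 0 ≤ ∑ j, ‖(ε : ℂ) * h j y‖ ^ 2 := by positivity
    linarith [hfB y hy]
  · intro x hx v hv
    refine hinj x hx v fun j => ?_
    have h1 := hv (Sum.inr j)
    have hd : DifferentiableAt ℂ (h j ∘ (chartAt E x).symm) (chartAt E x x) :=
      (differentiableOn_comp_chart_symm (hh j) x).differentiableAt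
        ((chartAt E x).open_target.mem_nhds (mem_chart_target E x))
    have h2 : HasFDerivAt ((fun x => (ε : ℂ) * h j x) ∘ (chartAt E x).symm)
        ((ε : ℂ) • fderiv ℂ (h j ∘ (chartAt E x).symm) (chartAt E x x)) (chartAt E x x) :=
      hd.hasFDerivAt.const_mul (ε : ℂ)
    simp only [Sum.elim_inr] at h1
    rw [h2.fderiv] at h1
    simpa [hε0.ne'] using h1

end SteinFamilies

/-! ### Differentiation under the integral over a compact manifold -/

section ParametricIntegral

variable {G : Type*} [TopologicalSpace G] [CompactSpace G] [MeasurableSpace G] [BorelSpace G]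
  (μ : Measure G) [IsFiniteMeasure μ]
  {E : Type*} [NormedAddCommGroup E] [NormedSpace ℝ E] [FiniteDimensional ℝ E]
  {F : Type*} [NormedAddCommGroup F] [NormedSpace ℝ F] [FiniteDimensional ℝ F]

theorem integrable_of_continuous_of_compactSpace {f : G → F} (hf : Continuous f) :
    Integrable f μ := by
  have : ProperSpace F := FiniteDimensional.proper ℝ F
  obtain ⟨C, hC⟩ := (isCompact_range hf.norm).bddAbove
  exact (integrable_const C).mono' hf.aestronglyMeasurable
    (Eventually.of_forall fun g => hC (mem_range_self g))

/-- Differentiation under the integral sign over a compact space. -/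
theorem hasFDerivAt_integral_of_compactSpace {ψ : G → E → F} {ψ' : G → E → E →L[ℝ] F} {U : Set E}
    (hU : IsOpen U) (hψ : ∀ g, ∀ z ∈ U, HasFDerivAt (ψ g) (ψ' g z) z)
    (hc : ContinuousOn (fun p : G × E => ψ p.1 p.2) (univ ×ˢ U))
    (hc' : ContinuousOn (fun p : G × E => ψ' p.1 p.2) (univ ×ˢ U)) {z : E} (hz : z ∈ U) :
    HasFDerivAt (fun y => ∫ g, ψ g y ∂μ) (∫ g, ψ' g z ∂μ) z := by
  have : ProperSpace E := FiniteDimensional.proper ℝ E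
  obtain ⟨r, hr, hrU⟩ := Metric.nhds_basis_closedBall.mem_iff.1 (hU.mem_nhds hz)
  have hsec : ∀ y ∈ U, Continuous fun g => ψ g y := fun y hy =>
    hc.comp_continuous (by fun_prop : Continuous fun g : G => (g, y)) fun g => ⟨mem_univ _, hy⟩
  have hsec' : ∀ y ∈ U, Continuous fun g => ψ' g y := fun y hy =>
    hc'.comp_continuous (by fun_prop : Continuous fun g : G => (g, y)) fun g => ⟨mem_univ _, hy⟩
  have hK : IsCompact ((univ : Set G) ×ˢ closedBall z r) :=
    isCompact_univ.prod (isCompact_closedBall z r)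
  obtain ⟨C, hC⟩ := (hK.image_of_continuousOn
    (hc'.mono (prod_mono_right hrU)).norm).bddAbove
  have hs : closedBall z r ∈ 𝓝 z := closedBall_mem_nhds z hr
  exact hasFDerivAt_integral_of_dominated_of_fderiv_le (bound := fun _ => C) hs
    (eventually_of_mem hs fun y hy =>
      (integrable_of_continuous_of_compactSpace μ (hsec y (hrU hy))).aestronglyMeasurable)
    (integrable_of_continuous_of_compactSpace μ (hsec z hz))
    (integrable_of_continuous_of_compactSpace μ (hsec' z hz)).aestronglyMeasurable
    (Eventually.of_forall fun g y hy => hC ⟨(g, y), ⟨mem_univ _, hy⟩, rfl⟩)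
    (integrable_const C) (Eventually.of_forall fun g y hy => hψ g y (hrU hy))

end ParametricIntegral

section JointSmoothness

variable {EG : Type*} [NormedAddCommGroup EG] [NormedSpace ℝ EG]
  {HG : Type*} [TopologicalSpace HG] {I : ModelWithCorners ℝ EG HG}
  {G : Type*} [TopologicalSpace G] [ChartedSpace HG G] [IsManifold I 1 G]
  {E : Type*} [NormedAddCommGroup E] [NormedSpace ℝ E]
  {F : Type*} [NormedAddCommGroup F] [NormedSpace ℝ F]

/-- The partial derivative in the vector variable of a jointly smooth function is
jointly smooth. -/
theorem ContMDiffOn.partial_fderiv {ψ : G → E → F} {U : Set E} (hU : IsOpen U)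
    (hψ : ContMDiffOn (I.prod 𝓘(ℝ, E)) 𝓘(ℝ, F) ∞ (fun p : G × E => ψ p.1 p.2) (univ ×ˢ U)) :
    ContMDiffOn (I.prod 𝓘(ℝ, E)) 𝓘(ℝ, E →L[ℝ] F) ∞
      (fun p : G × E => fderiv ℝ (ψ p.1) p.2) (univ ×ˢ U) := by
  rintro ⟨g, z⟩ hp
  have hO : IsOpen ((univ : Set G) ×ˢ U) := isOpen_univ.prod hU
  have h1 : ContMDiffAt (I.prod 𝓘(ℝ, E)) 𝓘(ℝ, F) ∞ (fun p : G × E => ψ p.1 p.2) (g, z) :=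
    hψ.contMDiffAt (hO.mem_nhds hp)
  -- The base point is made part of the parameter `p`, so that the derivative is taken at `p.2`,
  -- although the function depends on `p.1` only.
  have h2 : ContMDiffAt ((I.prod 𝓘(ℝ, E)).prod 𝓘(ℝ, E)) 𝓘(ℝ, F) ∞
      (Function.uncurry fun (p : G × E) (y : E) => ψ p.1 y) ((g, z), z) := by
    have h3 : ContMDiffAt ((I.prod 𝓘(ℝ, E)).prod 𝓘(ℝ, E)) (I.prod 𝓘(ℝ, E)) ∞
        (fun q : (G × E) × E => (q.1.1, q.2)) ((g, z), z) :=
      (contMDiffAt_fst.comp _ contMDiffAt_fst).prodMk contMDiffAt_snd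
    exact ContMDiffAt.comp (g := fun p : G × E => ψ p.1 p.2) ((g, z), z) h1 h3
  have h4 := ContMDiffAt.mfderiv (x₀ := (g, z)) (fun (p : G × E) (y : E) => ψ p.1 y) Prod.snd
    h2 (contMDiffAt_snd (n := ∞)) (by simp)
  simp only [inTangentCoordinates_model_space, mfderiv_eq_fderiv] at h4
  exact h4.contMDiffWithinAt

end JointSmoothness

/-! ### The Levi form of a sum of squared moduli -/

section Calculus

open scoped InnerProductSpace

variable {E : Type*} [NormedAddCommGroup E] [NormedSpace ℂ E]

theorem hasFDerivAt_norm_sq_complex {f : E → ℂ} {z : E} (hf : DifferentiableAt ℂ f z) :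
    HasFDerivAt (fun y => ‖f y‖ ^ 2)
      (2 • (innerSL ℝ (f z)).comp ((fderiv ℂ f z).restrictScalars ℝ)) z :=
  (hf.hasFDerivAt.restrictScalars ℝ).norm_sq

/-- The Laplacian of `‖f‖ ^ 2` along a complex line, for `f` holomorphic. -/
theorem levi_norm_sq {f : E → ℂ} {U : Set E} (hU : IsOpen U) (hf : ContDiffOn ℂ ∞ f U) {z : E}
    (hz : z ∈ U) (v : E) :
    fderiv ℝ (fderiv ℝ fun y => ‖f y‖ ^ 2) z v v +
      fderiv ℝ (fderiv ℝ fun y => ‖f y‖ ^ 2) z (Complex.I • v) (Complex.I • v) =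
      4 * ‖fderiv ℂ f z v‖ ^ 2 := by
  have hd : ∀ y ∈ U, DifferentiableAt ℂ f y := fun y hy =>
    (hf.differentiableOn (by simp)).differentiableAt (hU.mem_nhds hy)
  have hA : DifferentiableAt ℂ (fderiv ℂ f) z :=
    ((hf.fderiv_of_isOpen hU (m := ∞) (by simp)).differentiableOn
      (by simp)).differentiableAt (hU.mem_nhds hz)
  have hsm : ContDiffAt ℝ 2 (fun y => ‖f y‖ ^ 2) z :=
    ((hf.restrict_scalars ℝ).contDiffAt (hU.mem_nhds hz)).norm_sq ℝ |>.of_le ENat.LEInfty.out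
  have hdd : DifferentiableAt ℝ (fderiv ℝ fun y => ‖f y‖ ^ 2) z :=
    (hsm.fderiv_right (m := 1) (by norm_num)).differentiableAt (by simp)
  have key : ∀ w, fderiv ℝ (fderiv ℝ fun y => ‖f y‖ ^ 2) z w w =
      2 * (⟪f z, fderiv ℂ (fderiv ℂ f) z w w⟫_ℝ + ⟪fderiv ℂ f z w, fderiv ℂ f z w⟫_ℝ) := by
    intro w
    have h1 : HasFDerivAt (fun y => fderiv ℝ (fun y => ‖f y‖ ^ 2) y w)
        ((ContinuousLinearMap.apply ℝ ℝ w).comp (fderiv ℝ (fderiv ℝ fun y => ‖f y‖ ^ 2) z)) z :=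
      (ContinuousLinearMap.apply ℝ ℝ w).hasFDerivAt.comp z hdd.hasFDerivAt
    have h2 : HasFDerivAt (fun y => fderiv ℂ f y w)
        ((ContinuousLinearMap.apply ℂ ℂ w).comp (fderiv ℂ (fderiv ℂ f) z)) z :=
      (ContinuousLinearMap.apply ℂ ℂ w).hasFDerivAt.comp z hA.hasFDerivAt
    have h3 := (((hd z hz).hasFDerivAt.restrictScalars ℝ).inner ℝ
      (h2.restrictScalars ℝ)).const_mul (2 : ℝ)
    have h4 : (fun y => fderiv ℝ (fun y => ‖f y‖ ^ 2) y w) =ᶠ[𝓝 z]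
        fun y => 2 * ⟪f y, fderiv ℂ f y w⟫_ℝ := by
      filter_upwards [hU.mem_nhds hz] with y hy
      rw [(hasFDerivAt_norm_sq_complex (hd y hy)).fderiv]
      simp [mul_add]
    have h5 := (h3.congr_of_eventuallyEq h4).unique h1
    have h6 := congrArg (fun L : E →L[ℝ] ℝ => L w) h5
    simpa using h6.symm
  rw [key, key]
  -- The second derivative of `f` is complex bilinear, so its values at (v, v) and (iv, iv) cancel.
  simp only [map_smul, smul_apply, real_inner_self_eq_norm_sq, norm_smul,
    Complex.norm_I, one_mul, smul_smul, Complex.I_mul_I, neg_smul, one_smul, inner_neg_right]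
  ring

theorem levi_sum_norm_sq {ι : Type*} [Fintype ι] {f : ι → E → ℂ} {U : Set E} (hU : IsOpen U)
    (hf : ∀ i, ContDiffOn ℂ ∞ (f i) U) {z : E} (hz : z ∈ U) (v : E) :
    fderiv ℝ (fderiv ℝ fun y => ∑ i, ‖f i y‖ ^ 2) z v v +
      fderiv ℝ (fderiv ℝ fun y => ∑ i, ‖f i y‖ ^ 2) z (Complex.I • v) (Complex.I • v) =
      4 * ∑ i, ‖fderiv ℂ (f i) z v‖ ^ 2 := by
  have hsm : ∀ i, ∀ y ∈ U, ContDiffAt ℝ 2 (fun y => ‖f i y‖ ^ 2) y := fun i y hy =>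
    (((hf i).restrict_scalars ℝ).contDiffAt (hU.mem_nhds hy)).norm_sq ℝ |>.of_le ENat.LEInfty.out
  have h1 : (fderiv ℝ fun y => ∑ i, ‖f i y‖ ^ 2) =ᶠ[𝓝 z]
      fun y => ∑ i, fderiv ℝ (fun y => ‖f i y‖ ^ 2) y := by
    filter_upwards [hU.mem_nhds hz] with y hy
    exact fderiv_fun_sum fun i _ => (hsm i y hy).differentiableAt (by simp)
  have h2 : fderiv ℝ (fun y => ∑ i, fderiv ℝ (fun y => ‖f i y‖ ^ 2) y) z =
      ∑ i, fderiv ℝ (fderiv ℝ fun y => ‖f i y‖ ^ 2) z :=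
    fderiv_fun_sum fun i _ =>
      ((hsm i z hz).fderiv_right (m := 1) (by norm_num)).differentiableAt (by simp)
  rw [h1.fderiv_eq, h2]
  simp only [sum_apply]
  rw [← Finset.sum_add_distrib, Finset.mul_sum]
  exact Finset.sum_congr rfl fun i _ => levi_norm_sq hU (hf i) hz v

end Calculus

/-! ### Complex lines in real subspaces -/

section TotallyReal

variable {E : Type*} [NormedAddCommGroup E] [NormedSpace ℂ E] [FiniteDimensional ℂ E]

/-- A real subspace of dimension greater than the complex dimension contains a complex line. -/
theorem exists_mem_I_smul_mem (V : Submodule ℝ E)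
    (hV : Module.finrank ℂ E < Module.finrank ℝ V) : ∃ v ≠ 0, v ∈ V ∧ Complex.I • v ∈ V := by
  have : FiniteDimensional ℝ E := FiniteDimensional.complexToReal E
  have hI : Complex.I ≠ 0 := Complex.I_ne_zero
  let J : E ≃ₗ[ℝ] E := (LinearEquiv.smulOfNeZero ℂ E Complex.I hI).restrictScalars ℝ
  have h1 : Module.finrank ℝ (V.map (J : E →ₗ[ℝ] E)) = Module.finrank ℝ V :=
    LinearEquiv.finrank_map_eq J V
  have h2 := Submodule.finrank_sup_add_finrank_inf_eq V (V.map (J : E →ₗ[ℝ] E))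
  have h3 := Submodule.finrank_le (V ⊔ V.map (J : E →ₗ[ℝ] E))
  have h4 : Module.finrank ℝ E = 2 * Module.finrank ℂ E := finrank_real_of_complex E
  -- The dimension of V ∩ iV is at least 2 dim V − 2 dim E, with dim V real and dim E complex.
  have h5 : V ⊓ V.map (J : E →ₗ[ℝ] E) ≠ ⊥ := by
    intro h
    rw [h, finrank_bot] at h2
    omega
  obtain ⟨w, ⟨hw, ⟨v, hv, hvw⟩⟩, hw0⟩ := Submodule.exists_mem_ne_zero_of_ne_bot h5
  have hvw' : Complex.I • v = w := hvw
  refine ⟨v, ?_, hv, hvw' ▸ hw⟩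
  rintro rfl
  exact hw0 (by rw [← hvw', smul_zero])

end TotallyReal

/-! ### Hessians of averages at local minima -/

section Average

variable {EG : Type*} [NormedAddCommGroup EG] [NormedSpace ℝ EG]
  {HG : Type*} [TopologicalSpace HG] {I : ModelWithCorners ℝ EG HG}
  {G : Type*} [TopologicalSpace G] [ChartedSpace HG G]
  {E : Type*} [NormedAddCommGroup E] [NormedSpace ℝ E]
  {F : Type*} [NormedAddCommGroup F] [NormedSpace ℝ F]

theorem ContMDiffOn.contDiffOn_section {ψ : G → E → F} {U : Set E}
    (hψ : ContMDiffOn (I.prod 𝓘(ℝ, E)) 𝓘(ℝ, F) ∞ (fun p : G × E => ψ p.1 p.2) (univ ×ˢ U))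
    (g : G) : ContDiffOn ℝ ∞ (ψ g) U := by
  rw [← contMDiffOn_iff_contDiffOn]
  have h : ContMDiff 𝓘(ℝ, E) (I.prod 𝓘(ℝ, E)) ∞ fun z : E => (g, z) :=
    contMDiff_const.prodMk contMDiff_id
  exact hψ.comp h.contMDiffOn fun z hz => ⟨mem_univ _, hz⟩

/-- Averages over a compact manifold of jointly smooth functions may be differentiated under
the integral sign. -/
theorem ContMDiffOn.hasFDerivAt_integral [IsManifold I 1 G] [FiniteDimensional ℝ E]
    [FiniteDimensional ℝ F] [CompactSpace G] [MeasurableSpace G] [BorelSpace G] (μ : Measure G)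
    [IsFiniteMeasure μ] {ψ : G → E → F} {U : Set E} (hU : IsOpen U)
    (hψ : ContMDiffOn (I.prod 𝓘(ℝ, E)) 𝓘(ℝ, F) ∞ (fun p : G × E => ψ p.1 p.2) (univ ×ˢ U))
    {z : E} (hz : z ∈ U) :
    HasFDerivAt (fun y => ∫ g, ψ g y ∂μ) (∫ g, fderiv ℝ (ψ g) z ∂μ) z :=
  hasFDerivAt_integral_of_compactSpace μ hU (fun g _ hy =>
    (((hψ.contDiffOn_section g).differentiableOn (by simp)).differentiableAt
      (hU.mem_nhds hy)).hasFDerivAt) hψ.continuousOn (hψ.partial_fderiv hU).continuousOn hz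

theorem ContMDiffOn.continuous_fderiv_fderiv_apply [IsManifold I 1 G] {ψ : G → E → F}
    {U : Set E} (hU : IsOpen U)
    (hψ : ContMDiffOn (I.prod 𝓘(ℝ, E)) 𝓘(ℝ, F) ∞ (fun p : G × E => ψ p.1 p.2) (univ ×ˢ U))
    {z : E} (hz : z ∈ U) (v w : E) :
    Continuous fun g => fderiv ℝ (fderiv ℝ (ψ g)) z v w := by
  have h := (hψ.partial_fderiv hU).partial_fderiv (ψ := fun g => fderiv ℝ (ψ g)) hU
  have h' : Continuous fun g => fderiv ℝ (fderiv ℝ (ψ g)) z :=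
    h.continuousOn.comp_continuous (f := fun g : G => (g, z)) (Continuous.prodMk_left z)
      fun g => ⟨mem_univ _, hz⟩
  exact (h'.clm_apply continuous_const).clm_apply continuous_const

/-- The Hessian of an average vanishes on the tangent directions of a family of local minima. -/
theorem ContMDiffOn.integral_hessian_eq_zero [IsManifold I 1 G] [FiniteDimensional ℝ E]
    [CompactSpace G] [MeasurableSpace G] [BorelSpace G] (μ : Measure G)
    [IsFiniteMeasure μ] {ψ : G → E → ℝ} {U : Set E} (hU : IsOpen U)
    (hψ : ContMDiffOn (I.prod 𝓘(ℝ, E)) 𝓘(ℝ, ℝ) ∞ (fun p : G × E => ψ p.1 p.2) (univ ×ˢ U))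
    {D : Type*} [NormedAddCommGroup D] [NormedSpace ℝ D] {c : D → E} {L : D →L[ℝ] E} {u : D}
    (hc : HasFDerivAt c L u) (hu : c u ∈ U)
    (hmin : ∀ᶠ t in 𝓝 u, IsLocalMin (fun y => ∫ g, ψ g y ∂μ) (c t)) (a : D) (w : E) :
    ∫ g, fderiv ℝ (fderiv ℝ (ψ g)) (c u) (L a) w ∂μ = 0 := by
  have hψ₁ := hψ.partial_fderiv hU
  have h := hψ₁.partial_fderiv (ψ := fun g => fderiv ℝ (ψ g)) hU
  have hcont : Continuous fun g => fderiv ℝ (fderiv ℝ (ψ g)) (c u) :=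
    h.continuousOn.comp_continuous (f := fun g : G => (g, c u)) (Continuous.prodMk_left _)
      fun g => ⟨mem_univ _, hu⟩
  have hint := integrable_of_continuous_of_compactSpace (F := E →L[ℝ] E →L[ℝ] ℝ) μ hcont
  have h1 := hψ₁.hasFDerivAt_integral (ψ := fun g => fderiv ℝ (ψ g)) μ hU hu
  -- The gradient vanishes along the whole family, so its derivative along `c`, which is the Hessian
  -- applied to `L a`, vanishes too.
  have hzero : (fun t => ∫ g, fderiv ℝ (ψ g) (c t) ∂μ) =ᶠ[𝓝 u] fun _ => 0 := by
    filter_upwards [hmin, hc.continuousAt.eventually_mem (hU.mem_nhds hu)] with t ht htU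
    exact ht.hasFDerivAt_eq_zero (hψ.hasFDerivAt_integral μ hU htU)
  have h2 : HasFDerivAt (fun t => ∫ g, fderiv ℝ (ψ g) (c t) ∂μ) _ u := h1.comp u hc
  have h3 := h2.unique ((hasFDerivAt_const (0 : E →L[ℝ] ℝ) u).congr_of_eventuallyEq hzero)
  have h4 := congrArg (fun T : D →L[ℝ] E →L[ℝ] ℝ => T a w) h3
  rw [← ContinuousLinearMap.integral_apply (hint.apply_continuousLinearMap (L a)),
    ← ContinuousLinearMap.integral_apply hint]
  exact h4

end Average

/-! ### Orbits of minima have totally real tangent spaces -/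

section OrbitOfMinimum

variable {EG : Type*} [NormedAddCommGroup EG] [NormedSpace ℝ EG]
  {HG : Type*} [TopologicalSpace HG] {I : ModelWithCorners ℝ EG HG}
  {G : Type*} [TopologicalSpace G] [ChartedSpace HG G] [Group G] [LieGroup I ∞ G]
  {E : Type*} [NormedAddCommGroup E] [NormedSpace ℂ E] [FiniteDimensional ℂ E]
  {X : Type*} [TopologicalSpace X] [ChartedSpace E X] [IsManifold 𝓘(ℂ, E) ω X]
  [MulAction G X]

theorem IsHolomorphicAction.contMDiffOn_sum_norm_sq (hG : IsHolomorphicAction I G E X)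
    {ι : Type*} [Fintype ι] {f : ι → X → ℂ}
    (hf : ∀ i, MDifferentiable 𝓘(ℂ, E) 𝓘(ℂ) (f i)) (x : X) :
    ContMDiffOn (I.prod 𝓘(ℝ, E)) 𝓘(ℝ, ℝ) ∞
      (fun p : G × E => ∑ i, ‖f i (p.1⁻¹ • (chartAt E x).symm p.2)‖ ^ 2)
      (univ ×ˢ (chartAt E x).target) := by
  have := isManifold_real_of_complex (E := E) (X := X)
  have hρ : ContMDiff 𝓘(ℝ, E) 𝓘(ℝ, ℝ) ∞ fun y : X => ∑ i, ‖f i y‖ ^ 2 :=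
    contMDiff_finsetSum fun i _ =>
      (contDiff_norm_sq (𝕜 := ℝ) (E := ℂ)).contMDiff.comp (hf i).contMDiff_real
  have hsymm : ContMDiffOn 𝓘(ℝ, E) 𝓘(ℝ, E) ∞ (chartAt E x).symm (chartAt E x).target :=
    contMDiffOn_chart_symm
  have hinv : ContMDiff (I.prod 𝓘(ℝ, E)) I ∞ fun p : G × E => p.1⁻¹ :=
    (contMDiff_inv I ∞).comp contMDiff_fst
  have h1 : ContMDiffOn (I.prod 𝓘(ℝ, E)) (I.prod 𝓘(ℝ, E)) ∞
      (fun p : G × E => (p.1⁻¹, (chartAt E x).symm p.2)) (univ ×ˢ (chartAt E x).target) :=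
    hinv.contMDiffOn.prodMk (hsymm.comp contMDiffOn_snd fun p hp => hp.2)
  exact hρ.comp_contMDiffOn (hG.smooth.contMDiff_smul.comp_contMDiffOn h1)

/-- If the average over `G` of `∑ i, ‖f i‖ ^ 2`, with `f i` holomorphic, is minimal along the orbit
of `x` and the differentials of the `f i` at `x` separate tangent vectors, then the tangent space
of the orbit is totally real. -/
theorem IsHolomorphicAction.orbitRealDim_le_of_average_min [I.Boundaryless] [CompactSpace G]
    [MeasurableSpace G] [BorelSpace G] (μ : Measure G) [IsFiniteMeasure μ] [μ.IsOpenPosMeasure]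
    (hG : IsHolomorphicAction I G E X) {ι : Type*} [Fintype ι] {f : ι → X → ℂ}
    (hf : ∀ i, MDifferentiable 𝓘(ℂ, E) 𝓘(ℂ) (f i)) (x : X) {O : Set X} (hO : IsOpen O)
    (hxO : ∀ g : G, g • x ∈ O)
    (hmin : ∀ g : G, ∀ y ∈ O, ∫ h : G, ∑ i, ‖f i (h⁻¹ • g • x)‖ ^ 2 ∂μ ≤
      ∫ h : G, ∑ i, ‖f i (h⁻¹ • y)‖ ^ 2 ∂μ)
    (hinj : ∀ v : E, (∀ i, fderiv ℂ (f i ∘ (chartAt E ((1 : G) • x)).symm)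
      (chartAt E ((1 : G) • x) ((1 : G) • x)) v = 0) → v = 0) :
    orbitRealDim I G E x ≤ Module.finrank ℂ E := by
  have hmanX := isManifold_real_of_complex (E := E) (X := X)
  have hsm := hG.smooth
  have hcs : ContinuousSMul G X := ContMDiffSMul.continuousSMul (I := I) (I' := 𝓘(ℝ, E)) ∞
  have : FiniteDimensional ℝ E := FiniteDimensional.complexToReal E
  -- The tangent space of the orbit sits at `1 • x`, which is not definitionally `x`.
  set e := chartAt E ((1 : G) • x) with he
  set z₀ : E := e ((1 : G) • x) with hz₀
  have hz₀U : z₀ ∈ e.target := mem_chart_target E _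
  have hψ := hG.contMDiffOn_sum_norm_sq hf ((1 : G) • x)
  have hlocmin : ∀ g : G, g • x ∈ e.source →
      IsLocalMin (fun z => ∫ h : G, ∑ i, ‖f i (h⁻¹ • e.symm z)‖ ^ 2 ∂μ) (e (g • x)) := by
    intro g hg
    have h1 : ContinuousAt e.symm (e (g • x)) := e.continuousAt_symm (e.mapsTo hg)
    have h2 : ∀ᶠ z in 𝓝 (e (g • x)), e.symm z ∈ O :=
      h1.eventually_mem (hO.mem_nhds (by rw [e.left_inv hg]; exact hxO g))
    filter_upwards [h2] with z hz
    simpa only [e.left_inv hg] using hmin g _ hz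
  have hmd : MDifferentiableAt I 𝓘(ℝ, E) (fun g : G => g • x) 1 := by
    have h1 : ContMDiff I (I.prod 𝓘(ℝ, E)) ∞ fun g : G => (g, x) :=
      contMDiff_id.prodMk contMDiff_const
    exact (hsm.contMDiff_smul.comp h1).mdifferentiable (by simp) 1
  let c : EG → E := writtenInExtChartAt I 𝓘(ℝ, E) 1 fun g : G => g • x
  -- The differential, retyped as a map between the model spaces instead of tangent spaces.
  obtain ⟨L, hLdef⟩ : ∃ L : @ContinuousLinearMap ℝ ℝ _ _ (RingHom.id ℝ) EG _ _ E _ _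
      NormedSpace.toModule NormedSpace.toModule,
      L = mfderiv I 𝓘(ℝ, E) (fun g : G => g • x) 1 := ⟨_, rfl⟩
  have hL : HasFDerivAt c L (extChartAt I (1 : G) 1) := by
    have : HasFDerivWithinAt c L (range I) (extChartAt I (1 : G) 1) := by
      rw [hLdef]; exact hmd.hasMFDerivAt.2
    rwa [I.range_eq_univ, hasFDerivWithinAt_univ] at this
  have hc₀ : c (extChartAt I (1 : G) 1) = z₀ := by
    simp [c, writtenInExtChartAt, extChartAt, z₀, e]
  have hev : ∀ᶠ u in 𝓝 (extChartAt I (1 : G) 1),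
      IsLocalMin (fun z => ∫ h : G, ∑ i, ‖f i (h⁻¹ • e.symm z)‖ ^ 2 ∂μ) (c u) := by
    have h1 : ContinuousAt (fun u => (extChartAt I (1 : G)).symm u • x) (extChartAt I (1 : G) 1) :=
      (continuousAt_extChartAt_symm (I := I) (1 : G)).smul continuousAt_const
    have h2 : e.source ∈ 𝓝 ((extChartAt I (1 : G)).symm (extChartAt I (1 : G) 1) • x) := by
      rw [extChartAt_to_inv]
      exact e.open_source.mem_nhds (mem_chart_source E _)
    filter_upwards [h1.eventually_mem h2] with u hu
    have h3 : c u = e ((extChartAt I (1 : G)).symm u • x) := by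
      simp [c, writtenInExtChartAt, extChartAt, e]
    rw [h3]
    exact hlocmin _ hu
  have hzero := ContMDiffOn.integral_hessian_eq_zero μ
    (ψ := fun g z => ∑ i, ‖f i (g⁻¹ • e.symm z)‖ ^ 2) e.open_target hψ hL (hc₀ ▸ hz₀U) hev
  rw [hc₀] at hzero
  have hcont := ContMDiffOn.continuous_fderiv_fderiv_apply
    (ψ := fun g z => ∑ i, ‖f i (g⁻¹ • e.symm z)‖ ^ 2) e.open_target hψ hz₀U
  have hint := fun v w => integrable_of_continuous_of_compactSpace μ (hcont v w)
  by_contra! hlt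
  have hlt' : Module.finrank ℂ E < Module.finrank ℝ (LinearMap.range L.toLinearMap) := by
    rw [hLdef]; exact hlt
  obtain ⟨v, hv0, ⟨a, ha⟩, ⟨b, hb⟩⟩ := exists_mem_I_smul_mem _ hlt'
  have ha' : L a = v := ha
  have hb' : L b = Complex.I • v := hb
  have hlevi := fun g => levi_sum_norm_sq (f := fun i z => f i (g⁻¹ • e.symm z)) e.open_target
    (fun i => contDiffOn_comp_chart_symm ((hf i).comp (hG.holomorphic g⁻¹)) _) hz₀U v
  have hsum := congrArg₂ (· + ·) (hzero a (L a)) (hzero b (L b))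
  simp only [ha', hb'] at hsum
  rw [add_zero, ← integral_add (hint _ _) (hint _ _)] at hsum
  have hcont2 := (hcont v v).add (hcont (Complex.I • v) (Complex.I • v))
  -- The integrand is nonnegative and continuous and `μ` charges open sets, so it vanishes at every
  -- `g`, in particular at `1`.
  have hae := (integral_eq_zero_iff_of_nonneg (fun g => by
    simp only [Pi.zero_apply, Pi.add_apply]; rw [hlevi g]; positivity) ((hint _ _).add (hint _ _))).1 hsum
  have h1 := congrFun ((hcont2.ae_eq_iff_eq μ continuous_zero).1 hae) 1
  simp only [Pi.zero_apply, Pi.add_apply] at h1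
  rw [hlevi 1] at h1
  refine hv0 (hinj v fun i => ?_)
  have h2 : ∑ i, ‖fderiv ℂ (fun z => f i ((1 : G)⁻¹ • e.symm z)) z₀ v‖ ^ 2 = 0 := by linarith
  have h3 := (Finset.sum_eq_zero_iff_of_nonneg fun i _ => by positivity).1 h2 i (Finset.mem_univ i)
  simp only [inv_one, one_smul] at h3
  exact norm_eq_zero.1 (pow_eq_zero_iff two_ne_zero |>.1 h3)

end OrbitOfMinimum

/-! ### Invariant compact neighbourhoods and the main theorem -/

section InvariantNeighbourhoods

variable {G : Type*} [TopologicalSpace G] [Group G]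
  {X : Type*} [TopologicalSpace X] [MulAction G X] [ContinuousSMul G X]

/-- A compact set has a compact neighbourhood that is invariant under a given compact group. -/
theorem IsCompact.exists_invariant_compact_superset [CompactSpace G] [LocallyCompactSpace X]
    {K : Set X} (hK : IsCompact K) :
    ∃ N : Set X, IsCompact N ∧ K ⊆ interior N ∧ ∀ g : G, ∀ x ∈ N, g • x ∈ N := by
  obtain ⟨N, hN, hKN⟩ := exists_compact_superset hK
  refine ⟨(fun p : G × X => p.1 • p.2) '' (univ ×ˢ N),
    (isCompact_univ.prod hN).image continuous_smul,
    hKN.trans (interior_mono fun x hx => ⟨(1, x), ⟨mem_univ _, hx⟩, one_smul _ x⟩), ?_⟩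
  rintro g _ ⟨⟨h, x⟩, ⟨-, hx⟩, rfl⟩
  exact ⟨(g * h, x), ⟨mem_univ _, hx⟩, mul_smul g h x⟩

/-- Each group element acts as a homeomorphism. Consequently the orbit of a point of `N \ interior
N` stays there, where the sum of squares is at least 1. -/
theorem smul_mem_interior_of_invariant {N : Set X}
    (hN : ∀ g : G, ∀ x ∈ N, g • x ∈ N) (g : G)
    {x : X} (hx : x ∈ interior N) : g • x ∈ interior N := by
  have hO : IsOpen ((fun y : X => g⁻¹ • y) ⁻¹' interior N) :=
    isOpen_interior.preimage (continuous_const_smul g⁻¹)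
  refine interior_maximal (fun y hy => ?_) hO (by simpa using hx)
  simpa using hN g _ (interior_subset hy)

end InvariantNeighbourhoods

/-- Every holomorphic action of a compact Lie group on a Stein manifold has an orbit of real
dimension at most the complex dimension of the manifold. -/
theorem corollary5p3 (n : ℕ)
    {E : Type*} [NormedAddCommGroup E] [NormedSpace ℂ E] [FiniteDimensional ℂ E]
    (hn : Module.finrank ℂ E = n)
    {X : Type*} [TopologicalSpace X] [T2Space X] [SecondCountableTopology X] [Nonempty X]
    [ChartedSpace E X] [IsManifold 𝓘(ℂ, E) ω X] (hX : IsSteinManifold E X)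
    {EG : Type*} [NormedAddCommGroup EG] [NormedSpace ℝ EG] [FiniteDimensional ℝ EG]
    {HG : Type*} [TopologicalSpace HG] (I : ModelWithCorners ℝ EG HG) [I.Boundaryless]
    {G : Type*} [TopologicalSpace G] [ChartedSpace HG G] [Group G] [LieGroup I ∞ G]
    [CompactSpace G] [MulAction G X] (hG : IsHolomorphicAction I G E X) :
    ∃ x : X, orbitRealDim I G E x ≤ n := by
  have : ProperSpace E := FiniteDimensional.proper ℂ E
  have : LocallyCompactSpace X := ChartedSpace.locallyCompactSpace E X
  have : IsTopologicalGroup G := topologicalGroup_of_lieGroup I ∞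
  have hsm := hG.smooth
  have : ContinuousSMul G X := ContMDiffSMul.continuousSMul (I := I) (I' := 𝓘(ℝ, E)) ∞
  let : MeasurableSpace G := borel G
  have : BorelSpace G := ⟨rfl⟩
  let μ : Measure G := Measure.haarMeasure ⊤
  obtain ⟨p⟩ := ‹Nonempty X›
  set C : Set X := range fun g : G => g • p with hCdef
  have hC : IsCompact C := isCompact_range (by fun_prop)
  have hpC : p ∈ C := ⟨1, one_smul G p⟩
  obtain ⟨N, hN, hKN, hNinv⟩ :=
    (hX.holomorphicallyConvex C hC).exists_invariant_compact_superset (G := G)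
  have hCN : C ⊆ interior N := fun x hx => hKN fun f _ c hc => hc x hx
  obtain ⟨ι, _, f, hf, hfC, hfB, hinj⟩ := hX.exists_family (B := N \ interior N) hC ⟨p, hpC⟩ hN
    (hN.diff isOpen_interior) fun y hy hy' => hy.2 (hKN hy')
  have hρ : Continuous fun x => ∑ i, ‖f i x‖ ^ 2 :=
    continuous_finsetSum _ fun i _ => (hf i).continuous.norm.pow 2
  have hint : ∀ x : X, Integrable (fun g : G => ∑ i, ‖f i (g⁻¹ • x)‖ ^ 2) μ := fun x =>
    integrable_of_continuous_of_compactSpace μ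
      (hρ.comp (by fun_prop : Continuous fun g : G => g⁻¹ • x))
  -- Substituting hg for g turns g⁻¹hx into g⁻¹x; averaging over inverses makes left invariance of
  -- Haar measure suffice.
  have hinv : ∀ (h : G) (x : X), ∫ g : G, ∑ i, ‖f i (g⁻¹ • h • x)‖ ^ 2 ∂μ =
      ∫ g : G, ∑ i, ‖f i (g⁻¹ • x)‖ ^ 2 ∂μ := fun h x => by
    rw [← integral_mul_left_eq_self (fun g : G => ∑ i, ‖f i (g⁻¹ • h • x)‖ ^ 2) h]
    simp [mul_smul]
  have hcont : Continuous fun x => ∫ g : G, ∑ i, ‖f i (g⁻¹ • x)‖ ^ 2 ∂μ := by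
    have h1 : Continuous fun q : X × G => ∑ i, ‖f i (q.2⁻¹ • q.1)‖ ^ 2 :=
      hρ.comp (by fun_prop : Continuous fun q : X × G => q.2⁻¹ • q.1)
    simpa using continuous_parametric_integral_of_continuous (μ := μ)
      (f := fun x g => ∑ i, ‖f i (g⁻¹ • x)‖ ^ 2) h1 isCompact_univ
  obtain ⟨x, hxN, hxmin⟩ := hN.exists_isMinOn ⟨p, interior_subset (hCN hpC)⟩ hcont.continuousOn
  have hμ : 0 < μ.real univ := by
    rw [measureReal_def]
    exact ENNReal.toReal_pos (NeZero.ne _) (measure_ne_top μ _)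
  -- Otherwise the average at `x` is at least μ(G), while at `p` it is at most (3/4) μ(G).
  have hxint : x ∈ interior N := by
    by_contra hx
    have h1 : ∫ g : G, ∑ i, ‖f i (g⁻¹ • p)‖ ^ 2 ∂μ ≤ ∫ _ : G, (3 / 4 : ℝ) ∂μ :=
      integral_mono (hint p) (integrable_const _) fun g => hfC _ ⟨g⁻¹, rfl⟩
    have h2 : ∫ _ : G, (1 : ℝ) ∂μ ≤ ∫ g : G, ∑ i, ‖f i (g⁻¹ • x)‖ ^ 2 ∂μ := by
      refine integral_mono (integrable_const _) (hint x) fun g => hfB _ ⟨hNinv _ _ hxN, fun h => ?_⟩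
      exact hx (by simpa using smul_mem_interior_of_invariant hNinv g h)
    have h3 := hxmin (interior_subset (hCN hpC))
    simp only [integral_const, smul_eq_mul] at h1 h2
    have h4 : ∫ g : G, ∑ i, ‖f i (g⁻¹ • x)‖ ^ 2 ∂μ ≤ ∫ g : G, ∑ i, ‖f i (g⁻¹ • p)‖ ^ 2 ∂μ := h3
    linarith
  refine ⟨x, hn ▸ hG.orbitRealDim_le_of_average_min μ hf x isOpen_interior
    (fun g => smul_mem_interior_of_invariant hNinv g hxint) (fun g y hy => ?_)
    (hinj _ (hNinv 1 x hxN))⟩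
  rw [hinv g x]
  exact hxmin (interior_subset hy)
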